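/- **Setting.** Let $\mathcal S,\mathcal J,\mathcal K$ be finite sets, let $(\mathcal K_j)_{j\in\mathcal J}$ be a partition of $\mathcal K$, and let $\pi_s\ge 0$ with $\sum_s\pi_s=1$. For each $(s,j)$ let $(\mathcal N_{sj},\mathcal A_{sj})$ be a finite directed network (parallel arcs allowed). All data are real. Consider $$(\star)\quad\min\ \sum_{j}\sum_{k\in\mathcal K_j}c_kx_k+\sum_{s,j}\pi_s\sum_{a\in\mathcal A_{sj}}g_ay_a$$ subject to $Ax\ge b$, to the flow balance constraints $\sum_{a\text{ out of }n}y_a-\sum_{a\text{ into }n}y_a=\sum_{k\in\mathcal K_j}b_{nsk}x_k$ for all $s,j$ and $n\in\mathcal N_{sj}$, to the side constraints $\sum_{a\in\mathcal A_{sj}}f_{asj}y_a\ge h_{sj}$, and to the domains: each $x_k$ is real, integer or binary, and each $y_a$ is nonnegative real, nonnegative integer or binary. The partial relaxation (MIO–LO) replaces the domains of the $y_a$ by $y_a\ge 0$. For fixed $x$ it splits into Benders subproblems, one for each $(s,j)$, with dual polyhedra $$\mathcal P_{sj}=\{(\psi,\gamma):\gamma\ge0,\ \psi_m-\psi_n+\gamma^\top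 f_{asj}\le g_a\ \text{for every arc }a=(m,n)\in\mathcal A_{sj}\},$$ assumed non-empty. Extreme points and extreme rays of $\mathcal P_{sj}$ are those of its standard form, in which $\psi=\psi^+-\psi^-$ with $\psi^\pm\ge0$; each extreme ray is represented by its vector of coordinate sum one. The cut value of such a vector at $x$ is $\sum_{n}\sum_{k\in\mathcal K_j}b_{nsk}x_k\psi_n+h_{sj}^\top\gamma$. **Double-decomposition algorithm.** It keeps sets $\mathcal U_{sj}$ of extreme points and $\mathcal V_{sj}$ of extreme rays of $\mathcal P_{sj}$, with arbitrary initial values. It repeats the following. 1. Solve the master problem: minimize $c^\top x+\sum_{s,j}\pi_s\theta_{sj}$ over $(x,\theta)$ such that $Ax\ge b$, $x$ lies in its mixed-integer domain, $\theta_{sj}$ is at least the cut value at $x$ of each element of $\mathcal U_{sj}$, and the cut value at $x$ of each element of $\mathcal V_{sj}$ is at most $0$. If it is infeasible, stop with the answer "infeasible". Otherwise take any optimal solution $(x,\theta)$. 2. Column generation: start from any arc sets $\mathcal A'_{sj}\subseteq\mathcal A_{sj}$. Solve the Benders subproblems at $x$ restricted to $\mathcal A'_{sj}$; each solve yields optimal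 primal and dual solutions or, in case of infeasibility, a ray of the restricted dual polyhedron with positive cut value at $x$. For each $(s,j)$ compute the minimum over $a=(m,n)\in\mathcal A_{sj}$ of the reduced cost $g_a-(\psi_m-\psi_n)-\gamma^\top f_{asj}$ (with $g_a$ replaced by $0$ for a ray) and, if it is negative, add an arc attaining it to $\mathcal A'_{sj}$. Repeat until no minimum is negative. 3. If every subproblem is feasible with value at most $\theta_{sj}$, stop and return $(x,y)$, where $y$ is the primal solution extended by zero, together with the lower bound $LB=c^\top x+\sum_{s,j}\pi_s\theta_{sj}$. Otherwise, for every $(s,j)$, add to $\mathcal U_{sj}$ the dual solution, chosen to be an extreme point of $\mathcal P_{sj}$, if the subproblem is feasible, and add to $\mathcal V_{sj}$ the dual ray, chosen to be an extreme ray, if it is infeasible; return to 1. **Theorem 1.** The following hold whichever choices are made in the algorithm. - Finiteness: for given data and initial cuts there is a common bound on the total number of iterations (of both loops) of all runs. - A run can stop only by returning a solution, by the answer "infeasible", or at a master problem that is feasible but has no optimal solution. The last case cannot occur if $\{x:Ax\ge b,\ x\text{ in its mixed-integer domain}\}$ is bounded and all initial $\mathcal U_{sj}$ are non-empty. - If the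 answer is "infeasible", then (MIO–LO) is infeasible. - If $(x,y)$ is returned, then $(x,y)$ is an optimal solution of (MIO–LO) and its value is $LB$. - Valid optimality gap: if $(x,y)$ is returned, then $LB\le \mathrm{OPT}\le \mathrm{OPT}(x)$, where $\mathrm{OPT}$ is the optimal value of $(\star)$ and $\mathrm{OPT}(x)$ is the optimal value of $(\star)$ with the first stage fixed to $x$ (values $+\infty$ if infeasible). For every second-stage solution $y'$ that satisfies the constraints and the discrete requirements at $x$, the pair $(x,y')$ is feasible for $(\star)$, its value exceeds $LB$ by some $\mathrm{gap}\ge0$, and this value is at most $\mathrm{gap}$ larger than the value of any feasible solution of $(\star)$. -/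

import Mathlib

open Set Finset
open scoped BigOperators

/-- Kind of a decision variable. -/
inductive VarKind where
  | real
  | integer
  | binary

/-- Domain of a first-stage variable. -/
def VarKind.firstStageDomain : VarKind → Set ℝ
  | .real => Set.univ
  | .integer => Set.range (fun z : ℤ => (z : ℝ))
  | .binary => {0, 1}

/-- Domain of a (nonnegative) second-stage arc variable; its continuous relaxation is `[0, ∞)`. -/
def VarKind.arcDomain : VarKind → Set ℝ
  | .real => Set.Ici 0
  | .integer => Set.range (fun m : ℕ => (m : ℝ))
  | .binary => {0, 1}

/-- Data of a two-stage stochastic mixed-integer problem whose second stage is, for every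
scenario `s` and every block `j` of the partition of the first-stage variables, a network-flow
problem with side constraints. -/
structure TwoStageProblem where
  /-- scenarios -/
  S : Type
  /-- blocks of the partition of the first-stage indices -/
  J : Type
  /-- first-stage indices -/
  K : Type
  /-- first-stage constraints -/
  I : Type
  /-- nodes of the network of `(s, j)` -/
  Node : S → J → Type
  /-- arcs of the network of `(s, j)` -/
  Arc : S → J → Type
  /-- side constraints of `(s, j)` -/
  Side : S → J → Type
  [fintypeS : Fintype S]
  [fintypeJ : Fintype J]
  [fintypeK : Fintype K]
  [fintypeI : Fintype I]
  [fintypeNode : ∀ s j, Fintype (Node s j)]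
  [fintypeArc : ∀ s j, Fintype (Arc s j)]
  [fintypeSide : ∀ s j, Fintype (Side s j)]
  /-- the block that contains a first-stage index -/
  block : K → J
  /-- kinds of the first-stage variables -/
  xKind : K → VarKind
  /-- first-stage costs -/
  c : K → ℝ
  /-- matrix of the first-stage constraints `A x ≥ b` -/
  A : I → K → ℝ
  /-- right-hand side of the first-stage constraints `A x ≥ b` -/
  b : I → ℝ
  /-- scenario probabilities -/
  prob : S → ℝ
  prob_nonneg : ∀ s, 0 ≤ prob s
  prob_sum : ∑ s, prob s = 1
  /-- tail of an arc -/
  src : ∀ {s j}, Arc s j → Node s j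
  /-- head of an arc -/
  tgt : ∀ {s j}, Arc s j → Node s j
  /-- kinds of the second-stage variables -/
  yKind : ∀ {s j}, Arc s j → VarKind
  /-- arc costs -/
  g : ∀ {s j}, Arc s j → ℝ
  /-- net supply at a node per unit of a first-stage variable -/
  supply : ∀ {s j}, Node s j → K → ℝ
  /-- coefficients of the side constraints -/
  f : ∀ {s j}, Arc s j → Side s j → ℝ
  /-- right-hand sides of the side constraints -/
  h : ∀ {s j}, Side s j → ℝ

attribute [instance] TwoStageProblem.fintypeS TwoStageProblem.fintypeJ TwoStageProblem.fintypeK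
  TwoStageProblem.fintypeI TwoStageProblem.fintypeNode TwoStageProblem.fintypeArc
  TwoStageProblem.fintypeSide

noncomputable section

namespace TwoStageProblem

variable (D : TwoStageProblem)

/-- First-stage solutions. -/
abbrev XVec := D.K → ℝ

/-- Second-stage solutions, over all scenarios and blocks. -/
abbrev YVec := ∀ s j, D.Arc s j → ℝ

/-- Values of the recourse approximation variables of the master problem. -/
abbrev Theta := D.S → D.J → ℝ

/-! ### The problem and its partial relaxation -/

/-- The first-stage feasible set: mixed-integrality and `A x ≥ b`. -/
def firstStage : Set D.XVec :=
  {x | (∀ k, x k ∈ (D.xKind k).firstStageDomain) ∧ ∀ i, D.b i ≤ ∑ k, D.A i k * x k}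

/-- First-stage cost, summed block by block. -/
def xCost (x : D.XVec) : ℝ := by
  classical exact ∑ j, ∑ k with D.block k = j, D.c k * x k

/-- Second-stage cost of one scenario and block. -/
def yCost {s : D.S} {j : D.J} (y : D.Arc s j → ℝ) : ℝ := ∑ a, D.g a * y a

/-- Total objective. -/
def cost (x : D.XVec) (y : D.YVec) : ℝ :=
  D.xCost x + ∑ s, ∑ j, D.prob s * D.yCost (y s j)

/-- Net supply at node `n`, induced by the first-stage variables of the block `j`. -/
def netSupply {s : D.S} {j : D.J} (x : D.XVec) (n : D.Node s j) : ℝ := by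
  classical exact ∑ k with D.block k = j, D.supply n k * x k

/-- Flow balance and side constraints of `(s, j)`. -/
def Linking {s : D.S} {j : D.J} (x : D.XVec) (y : D.Arc s j → ℝ) : Prop := by
  classical exact
    (∀ n : D.Node s j,
      (∑ a with D.src a = n, y a) - (∑ a with D.tgt a = n, y a) = D.netSupply x n) ∧
    ∀ r : D.Side s j, D.h r ≤ ∑ a, D.f a r * y a

/-- `y` is feasible for the second-stage problem with discrete requirements at `x`. -/
def SPFeasible (x : D.XVec) (y : D.YVec) : Prop :=
  ∀ s j, D.Linking x (y s j) ∧ ∀ a, y s j a ∈ (D.yKind a).arcDomain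

/-- Feasibility for the full problem. -/
def FullFeasible (x : D.XVec) (y : D.YVec) : Prop :=
  x ∈ D.firstStage ∧ D.SPFeasible x y

/-- Optimal value of the full problem (`⊤` if infeasible). -/
def OPT : EReal := ⨅ (x : D.XVec) (y : D.YVec) (_ : D.FullFeasible x y), (D.cost x y : EReal)

/-- Total cost of `x`, with the second-stage problem with discrete requirements solved to
optimality (`⊤` if it is infeasible). -/
def OPTat (x : D.XVec) : EReal := ⨅ (y : D.YVec) (_ : D.SPFeasible x y), (D.cost x y : EReal)

/-- Feasibility for the restricted Benders subproblem of `(s, j)` at `x` with arc set `A'`; a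
variable whose arc is not in `A'` is absent, that is, zero. -/
def RSPFeasible {s : D.S} {j : D.J} (x : D.XVec) (A' : Set (D.Arc s j))
    (y : D.Arc s j → ℝ) : Prop :=
  D.Linking x y ∧ (∀ a, 0 ≤ y a) ∧ ∀ a, a ∉ A' → y a = 0

/-- Feasibility for the Benders subproblem (continuous second stage, all arcs). -/
def BSPFeasible {s : D.S} {j : D.J} (x : D.XVec) (y : D.Arc s j → ℝ) : Prop :=
  D.Linking x y ∧ ∀ a, 0 ≤ y a

/-- Feasibility for the partial relaxation: mixed-integer first stage, continuous second stage. -/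
def RelaxFeasible (x : D.XVec) (y : D.YVec) : Prop :=
  x ∈ D.firstStage ∧ ∀ s j, D.BSPFeasible x (y s j)

/-- Optimality for the partial relaxation. -/
def RelaxOptimal (x : D.XVec) (y : D.YVec) : Prop :=
  D.RelaxFeasible x y ∧ ∀ x' y', D.RelaxFeasible x' y' → D.cost x y ≤ D.cost x' y'

/-! ### Dual polyhedra -/

/-- The dual polyhedron of the subproblem of `(s, j)` with arc set `A'` and arc costs `w`, in the
variables `(ψ, γ)`. -/
def dualPoly {s : D.S} {j : D.J} (w : D.Arc s j → ℝ) (A' : Set (D.Arc s j)) :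
    Set ((D.Node s j → ℝ) × (D.Side s j → ℝ)) :=
  {p | (∀ r, 0 ≤ p.2 r) ∧
    ∀ a ∈ A', p.1 (D.src a) - p.1 (D.tgt a) + ∑ r, p.2 r * D.f a r ≤ w a}

/-- Dual vectors in standard form `(ψ⁺, ψ⁻, γ)`. -/
abbrev DualVec (s : D.S) (j : D.J) :=
  (D.Node s j → ℝ) × (D.Node s j → ℝ) × (D.Side s j → ℝ)

/-- The dual vector `(ψ⁺ - ψ⁻, γ)`. -/
def ofStd {s : D.S} {j : D.J} (z : D.DualVec s j) : (D.Node s j → ℝ) × (D.Side s j → ℝ) :=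
  (z.1 - z.2.1, z.2.2)

/-- The dual polyhedron in standard form. The polyhedron in `(ψ, γ)` contains lines (`ψ` can be
shifted by a constant) and so has no extreme points; writing the free variable as
`ψ = ψ⁺ - ψ⁻` with `ψ⁺, ψ⁻ ≥ 0` gives a pointed polyhedron. -/
def dualStd {s : D.S} {j : D.J} (w : D.Arc s j → ℝ) (A' : Set (D.Arc s j)) :
    Set (D.DualVec s j) :=
  {z | 0 ≤ z.1 ∧ 0 ≤ z.2.1 ∧ D.ofStd z ∈ D.dualPoly w A'}

/-- Dual objective at `x`; also the right-hand side of the Benders cut defined by `z`. -/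
def dualObj {s : D.S} {j : D.J} (x : D.XVec) (z : D.DualVec s j) : ℝ :=
  ∑ n, D.netSupply x n * (D.ofStd z).1 n + ∑ r, D.h r * (D.ofStd z).2 r

/-- Reduced cost of the arc `a` for arc costs `w`. -/
def redCost {s : D.S} {j : D.J} (w : D.Arc s j → ℝ) (z : D.DualVec s j) (a : D.Arc s j) : ℝ :=
  w a - ((D.ofStd z).1 (D.src a) - (D.ofStd z).1 (D.tgt a)) - ∑ r, (D.ofStd z).2 r * D.f a r

/-- Extreme points of the dual polyhedron of the Benders subproblem of `(s, j)`. -/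
def extPts (s : D.S) (j : D.J) : Set (D.DualVec s j) :=
  Set.extremePoints ℝ (D.dualStd (s := s) (j := j) D.g Set.univ)

/-- Extreme rays of the dual polyhedron, each represented by its vector of coordinate sum one:
the extreme points of the corresponding slice of the recession cone. -/
def extRays (s : D.S) (j : D.J) : Set (D.DualVec s j) :=
  Set.extremePoints ℝ
    {z | z ∈ D.dualStd (s := s) (j := j) 0 Set.univ ∧
      ∑ n, z.1 n + ∑ n, z.2.1 n + ∑ r, z.2.2 r = 1}

/-! ### The Benders master problem -/

/-- A set of dual vectors for each scenario and block. -/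
abbrev Cuts := ∀ s j, Set (D.DualVec s j)

/-- Objective of the master problem. -/
def masterObj (x : D.XVec) (θ : D.Theta) : ℝ := D.xCost x + ∑ s, ∑ j, D.prob s * θ s j

/-- Feasibility for the master problem with optimality cuts `U` and feasibility cuts `V`. -/
def MPFeasible (U V : D.Cuts) (x : D.XVec) (θ : D.Theta) : Prop :=
  x ∈ D.firstStage ∧ (∀ s j, ∀ u ∈ U s j, D.dualObj x u ≤ θ s j) ∧
    ∀ s j, ∀ v ∈ V s j, D.dualObj x v ≤ 0

/-- Optimality for the master problem. -/
def MPOptimal (U V : D.Cuts) (x : D.XVec) (θ : D.Theta) : Prop :=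
  D.MPFeasible U V x θ ∧
    ∀ x' θ', D.MPFeasible U V x' θ' → D.masterObj x θ ≤ D.masterObj x' θ'

/-! ### The column generation loop -/

/-- What the linear solver returns on a restricted subproblem: a primal and a dual solution, or a
dual ray that proves infeasibility. -/
inductive LPOut (s : D.S) (j : D.J) where
  | solved (y : D.Arc s j → ℝ) (z : D.DualVec s j)
  | infeasible (z : D.DualVec s j)

variable {D}

/-- The answer is correct for the restricted subproblem at `x` with arc set `A'`: optimal primal
and dual solutions, or infeasibility with an improving ray of the dual polyhedron. -/
def LPOut.Correct {s : D.S} {j : D.J} (x : D.XVec) (A' : Set (D.Arc s j)) : D.LPOut s j → Prop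
  | .solved y z =>
      (D.RSPFeasible x A' y ∧ ∀ y', D.RSPFeasible x A' y' → D.yCost y ≤ D.yCost y') ∧
      (z ∈ D.dualStd D.g A' ∧ ∀ z' ∈ D.dualStd D.g A', D.dualObj x z' ≤ D.dualObj x z)
  | .infeasible z =>
      (¬ ∃ y, D.RSPFeasible x A' y) ∧ z ∈ D.dualStd 0 A' ∧ 0 < D.dualObj x z

/-- Reduced costs in the pricing problem; a ray is priced with zero arc costs. -/
def LPOut.rc {s : D.S} {j : D.J} : D.LPOut s j → D.Arc s j → ℝ
  | .solved _ z => D.redCost D.g z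
  | .infeasible z => D.redCost 0 z

/-- `A''` is obtained from `A'` by adding an optimal solution of the pricing problem if the optimal
reduced cost is negative; otherwise `A'' = A'`. -/
def LPOut.AddColumn {s : D.S} {j : D.J} (o : D.LPOut s j) (A' A'' : Set (D.Arc s j)) : Prop :=
  (∃ a, o.rc a < 0 ∧ (∀ a', o.rc a ≤ o.rc a') ∧ A'' = insert a A') ∨
    ((∀ a, 0 ≤ o.rc a) ∧ A'' = A')

/-- The master solution `(x, θ)` violates a Benders cut of `(s, j)`: the subproblem is infeasible,
or its value exceeds `θ`. -/
def LPOut.Violated {s : D.S} {j : D.J} (t : ℝ) : D.LPOut s j → Prop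
  | .solved y _ => t < D.yCost y
  | .infeasible _ => True

/-- The cut sets of `(s, j)` are enlarged by the dual solution, which has to be an extreme point, or
by the dual ray, which has to be an extreme ray. -/
def LPOut.AddCut {s : D.S} {j : D.J} (o : D.LPOut s j)
    (U V U' V' : Set (D.DualVec s j)) : Prop :=
  match o with
  | .solved _ z => z ∈ D.extPts s j ∧ U' = insert z U ∧ V' = V
  | .infeasible z => z ∈ D.extRays s j ∧ U' = U ∧ V' = insert z V

variable (D)

/-! ### The double-decomposition algorithm -/

/-- States of the algorithm. -/
inductive State where
  /-- about to solve the master problem with cuts `U`, `V` -/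
  | master (U V : D.Cuts)
  /-- about to solve the restricted subproblems with arc sets `A'` at the master solution -/
  | sub (U V : D.Cuts) (x : D.XVec) (θ : D.Theta) (A' : ∀ s j, Set (D.Arc s j))
  /-- stopped: problem infeasible -/
  | infeasible
  /-- stopped: `(x, y)` is returned, with the master value of `(x, θ)` as lower bound -/
  | optimal (x : D.XVec) (θ : D.Theta) (y : D.YVec)

/-- One iteration of a loop of the algorithm. Solvers may return any of their optimal solutions, and
column generation may start from any restricted arc sets. -/
inductive Step : D.State → D.State → Prop
  | masterInfeasible (U V : D.Cuts) (hMP : ¬ ∃ x θ, D.MPFeasible U V x θ) :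
      Step (.master U V) .infeasible
  | masterSolved (U V : D.Cuts) (x : D.XVec) (θ : D.Theta) (A' : ∀ s j, Set (D.Arc s j))
      (hMP : D.MPOptimal U V x θ) :
      Step (.master U V) (.sub U V x θ A')
  | addColumns (U V : D.Cuts) (x : D.XVec) (θ : D.Theta) (A' A'' : ∀ s j, Set (D.Arc s j))
      (out : ∀ s j, D.LPOut s j)
      (hout : ∀ s j, (out s j).Correct x (A' s j))
      (hneg : ∃ s j a, (out s j).rc a < 0)
      (hadd : ∀ s j, (out s j).AddColumn (A' s j) (A'' s j)) :
      Step (.sub U V x θ A') (.sub U V x θ A'')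
  | addCuts (U V U' V' : D.Cuts) (x : D.XVec) (θ : D.Theta) (A' : ∀ s j, Set (D.Arc s j))
      (out : ∀ s j, D.LPOut s j)
      (hout : ∀ s j, (out s j).Correct x (A' s j))
      (hpos : ∀ s j a, 0 ≤ (out s j).rc a)
      (hviol : ∃ s j, (out s j).Violated (θ s j))
      (hadd : ∀ s j, (out s j).AddCut (U s j) (V s j) (U' s j) (V' s j)) :
      Step (.sub U V x θ A') (.master U' V')
  | terminate (U V : D.Cuts) (x : D.XVec) (θ : D.Theta) (A' : ∀ s j, Set (D.Arc s j))
      (out : ∀ s j, D.LPOut s j) (y : D.YVec)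
      (hout : ∀ s j, (out s j).Correct x (A' s j))
      (hpos : ∀ s j a, 0 ≤ (out s j).rc a)
      (hviol : ¬ ∃ s j, (out s j).Violated (θ s j))
      (hy : ∀ s j, ∃ z, out s j = .solved (y s j) z) :
      Step (.sub U V x θ A') (.optimal x θ y)

/-- States that occur in a run started with the cuts `U₀`, `V₀`. -/
def Reachable (U₀ V₀ : D.Cuts) (σ : D.State) : Prop :=
  Relation.ReflTransGen D.Step (.master U₀ V₀) σ

/-- The run cannot be continued from the state `σ`. -/
def Halted (σ : D.State) : Prop := ¬ ∃ σ', D.Step σ σ'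

/-- The optimality gap that is reported when the second-stage problem with discrete requirements is
re-solved at `x` with result `y'`: upper bound minus lower bound. -/
def gap (x : D.XVec) (θ : D.Theta) (y' : D.YVec) : ℝ := D.cost x y' - D.masterObj x θ

end TwoStageProblem

end

/-! Validity of cuts: by weak duality, a vector of the dual polyhedron or of its recession cone
gives an inequality satisfied by every solution of (MIO–LO), with the second-stage costs in the
place of `θ`. So every master problem is a relaxation of (MIO–LO): its infeasibility transfers, and
its optimal value is a lower bound (`RelaxFeasible.mpFeasible`). If all subproblem values are at
most `θ`, the extended primal solution attains this bound. Since (MIO–LO) in turn relaxes the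
discrete problem, the gap statements follow.

Progress: nonnegative reduced costs on all arcs mean that the restricted dual answer is feasible for
the full dual. Strong duality makes its cut value equal to the subproblem value, and a ray has
positive cut value, so a violated subproblem yields a cut that the master solution fails and that
was therefore not present (`LPOut.AddCut.exists_new`). An arc with negative reduced cost is likewise
new. Arcs, extreme points and normalized extreme rays are finite in number, so a count of missing
cuts, refined by missing arcs, strictly decreases at each iteration (`Step.remaining_lt`).

It remains to see that no step gets stuck. Farkas' lemma and strong duality supply correct solver
answers, a nonempty dual ruling out unboundedness. In standard form the dual polyhedron lies in an
orthant, so bounding the coordinate sum makes it compact; this supplies the required extreme points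
and rays. Compactness of the first stage gives solvability of the master problem. -/

/-! ### Farkas' lemma and linear programming duality -/

/-- **Farkas' lemma** for finitely many linear functionals on a real vector space. -/
theorem exists_nonneg_combination_of_forall_nonpos {E ι : Type*} [AddCommGroup E] [Module ℝ E]
    (s : Finset ι) (a : ι → E →ₗ[ℝ] ℝ) (b : E →ₗ[ℝ] ℝ)
    (hb : ∀ x, (∀ i ∈ s, a i x ≤ 0) → b x ≤ 0) :
    ∃ c : ι → ℝ, (∀ i, 0 ≤ c i) ∧ b = ∑ i ∈ s, c i • a i := by
  classical
  induction s using Finset.induction_on generalizing a b with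
  | empty =>
    refine ⟨0, fun _ => le_rfl, ?_⟩
    ext x
    have h1 := hb x (by simp)
    have h2 := hb (-x) (by simp)
    simp only [map_neg] at h2
    simp only [Finset.sum_empty, LinearMap.zero_apply]
    linarith
  | insert i₀ s hi₀ ih =>
    -- Either the new functional is not needed and gets coefficient zero, or some `x₀` shows that it
    -- is. In the second case all functionals are composed with the projection along `x₀` onto the
    -- kernel of `a i₀`, where the induction hypothesis applies.
    by_cases hs : ∀ x, (∀ i ∈ s, a i x ≤ 0) → b x ≤ 0
    · obtain ⟨c, hc, hbc⟩ := ih a b hs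
      refine ⟨fun i => if i = i₀ then 0 else c i, fun i => ?_, ?_⟩
      · beta_reduce
        split_ifs
        exacts [le_rfl, hc i]
      · rw [Finset.sum_insert hi₀, hbc]
        simp only [if_true, zero_smul, zero_add]
        refine Finset.sum_congr rfl fun i hi => ?_
        rw [if_neg (ne_of_mem_of_not_mem hi hi₀)]
    · push Not at hs
      obtain ⟨x₀, hx₀, hbx₀⟩ := hs
      have ha₀ : 0 < a i₀ x₀ := by
        by_contra h
        push Not at h
        exact absurd (hb x₀ fun i hi => by
          rcases Finset.mem_insert.1 hi with rfl | hi
          exacts [h, hx₀ i hi]) (not_le.2 hbx₀)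
      set t := a i₀ x₀ with ht
      obtain ⟨c, hc, hbc⟩ := ih (fun i => a i - (a i x₀ / t) • a i₀) (b - (b x₀ / t) • a i₀) (by
        intro x hx
        have := hb (x - (a i₀ x / t) • x₀) (by
          intro i hi
          rcases Finset.mem_insert.1 hi with rfl | hi
          · simp only [map_sub, map_smul, smul_eq_mul, ← ht]
            rw [div_mul_cancel₀ _ ha₀.ne', sub_self]
          · have := hx i hi
            simp only [LinearMap.sub_apply, LinearMap.smul_apply, smul_eq_mul] at this
            simp only [map_sub, map_smul, smul_eq_mul]
            calc _ = a i x - a i x₀ / t * a i₀ x := by ring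
              _ ≤ 0 := this)
        simp only [map_sub, map_smul, smul_eq_mul] at this
        simp only [LinearMap.sub_apply, LinearMap.smul_apply, smul_eq_mul]
        calc _ = b x - a i₀ x / t * b x₀ := by ring
          _ ≤ 0 := this)
      -- The coefficient of `a i₀` collects the projection corrections. It is nonnegative because `b
      -- x₀` and `t` are positive while `a i x₀ ≤ 0` on `s`.
      refine ⟨fun i => if i = i₀ then b x₀ / t - ∑ i ∈ s, c i * (a i x₀ / t) else c i,
        fun i => ?_, ?_⟩
      · beta_reduce
        split_ifs
        · have : ∑ i ∈ s, c i * (a i x₀ / t) ≤ 0 := Finset.sum_nonpos fun i hi =>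
            mul_nonpos_of_nonneg_of_nonpos (hc i) (div_nonpos_of_nonpos_of_nonneg (hx₀ i hi) ha₀.le)
          have : 0 < b x₀ / t := div_pos hbx₀ ha₀
          linarith
        · exact hc i
      · rw [Finset.sum_insert hi₀]
        have h1 : ∑ i ∈ s, (if i = i₀ then b x₀ / t - ∑ i ∈ s, c i * (a i x₀ / t) else c i) • a i
            = ∑ i ∈ s, c i • a i := Finset.sum_congr rfl fun i hi => by
          rw [if_neg (ne_of_mem_of_not_mem hi hi₀)]
        beta_reduce
        rw [h1, if_pos rfl]
        ext x
        have h2 := LinearMap.congr_fun hbc x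
        simp only [LinearMap.sub_apply, LinearMap.smul_apply, LinearMap.sum_apply, smul_eq_mul,
          mul_sub, Finset.sum_sub_distrib, ← mul_assoc, ← Finset.sum_mul] at h2
        simp only [LinearMap.add_apply, LinearMap.smul_apply, LinearMap.sum_apply, smul_eq_mul]
        linarith

section LinearProgram

variable {R C : Type*} [Fintype R] [Fintype C]

/-- Farkas' lemma as a theorem of the alternative for `M y ≥ d`, `y ≥ 0`. -/
theorem exists_primal_or_exists_ray (M : R → C → ℝ) (d : R → ℝ) :
    (∃ y : C → ℝ, (∀ a, 0 ≤ y a) ∧ ∀ r, d r ≤ ∑ a, M r a * y a) ∨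
    ∃ z : R → ℝ, (∀ r, 0 ≤ z r) ∧ (∀ a, ∑ r, z r * M r a ≤ 0) ∧ 0 < ∑ r, d r * z r := by
  classical
  by_contra hcon
  push Not at hcon
  obtain ⟨hy, hz⟩ := hcon
  let e : R → (R → ℝ) →ₗ[ℝ] ℝ := fun r => LinearMap.proj r
  -- Without a ray, `d` is nonpositive on the cone of dual directions, hence a nonnegative
  -- combination of the columns of `M` and the negated unit functionals. The column multipliers form
  -- `y`; the others are the slacks.
  obtain ⟨c, hc, hdc⟩ := exists_nonneg_combination_of_forall_nonpos (Finset.univ : Finset (R ⊕ C))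
    (Sum.elim (fun r => -e r) fun a => ∑ r, M r a • e r) (∑ r, d r • e r) (by
      intro z hzz
      have h1 : ∀ r, 0 ≤ z r := fun r => by simpa [e] using hzz (Sum.inl r) (Finset.mem_univ _)
      have h2 : ∀ a, ∑ r, z r * M r a ≤ 0 := fun a => by
        simpa [e, mul_comm] using hzz (Sum.inr a) (Finset.mem_univ _)
      simpa [e] using hz z h1 h2)
  obtain ⟨r, hr⟩ := hy (fun a => c (Sum.inr a)) fun a => hc _
  have := LinearMap.congr_fun hdc (Pi.single r 1)
  simp [e, Pi.single_apply] at this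
  have h0 := hc (Sum.inl r)
  have h3 : ∑ a, M r a * c (Sum.inr a) = ∑ a, c (Sum.inr a) * M r a :=
    Finset.sum_congr rfl fun a _ => mul_comm _ _
  linarith

/-- Exchange of the order of summation in `zᵀ M y`. -/
theorem sum_mul_sum_mul_comm (M : R → C → ℝ) (z : R → ℝ) (y : C → ℝ) :
    ∑ r, z r * ∑ a, M r a * y a = ∑ a, (∑ r, z r * M r a) * y a := by
  simp only [Finset.mul_sum, Finset.sum_mul]
  rw [Finset.sum_comm]
  exact Finset.sum_congr rfl fun a _ => Finset.sum_congr rfl fun r _ => by ring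

/-- Weak duality of linear programming; a dual inequality matters only on the support of `y`. -/
theorem weak_duality (M : R → C → ℝ) (d : R → ℝ) (w : C → ℝ) (y : C → ℝ)
    (z : R → ℝ) (hy : ∀ a, 0 ≤ y a) (hMy : ∀ r, d r ≤ ∑ a, M r a * y a) (hz : ∀ r, 0 ≤ z r)
    (hzM : ∀ a, y a ≠ 0 → ∑ r, z r * M r a ≤ w a) :
    ∑ r, d r * z r ≤ ∑ a, w a * y a := by
  calc ∑ r, d r * z r ≤ ∑ r, z r * ∑ a, M r a * y a := Finset.sum_le_sum fun r _ => by
        rw [mul_comm]; exact mul_le_mul_of_nonneg_left (hMy r) (hz r)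
    _ = ∑ a, (∑ r, z r * M r a) * y a := sum_mul_sum_mul_comm M z y
    _ ≤ ∑ a, w a * y a := Finset.sum_le_sum fun a _ => by
        by_cases h : y a = 0
        · simp [h]
        · exact mul_le_mul_of_nonneg_right (hzM a h) (hy a)

/-- **Strong duality** of linear programming: feasible primal and dual problems have solutions
without duality gap. -/
theorem strong_duality (M : R → C → ℝ) (d : R → ℝ) (w : C → ℝ)
    (hp : ∃ y : C → ℝ, (∀ a, 0 ≤ y a) ∧ ∀ r, d r ≤ ∑ a, M r a * y a)
    (hd : ∃ z : R → ℝ, (∀ r, 0 ≤ z r) ∧ ∀ a, ∑ r, z r * M r a ≤ w a) :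
    ∃ (y : C → ℝ) (z : R → ℝ), ((∀ a, 0 ≤ y a) ∧ ∀ r, d r ≤ ∑ a, M r a * y a) ∧
      ((∀ r, 0 ≤ z r) ∧ ∀ a, ∑ r, z r * M r a ≤ w a) ∧ ∑ a, w a * y a ≤ ∑ r, d r * z r := by
  classical
  obtain ⟨y₀, hy₀, hMy₀⟩ := hp
  obtain ⟨z₀, hz₀, hzM₀⟩ := hd
  -- One system in `(y, z)` encodes primal feasibility, dual feasibility and the reverse of weak
  -- duality. A Farkas ray `(u, v, t)` against it must be excluded.
  rcases exists_primal_or_exists_ray (R := R ⊕ C ⊕ Unit) (C := C ⊕ R)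
    (Sum.elim (fun r => Sum.elim (fun a => M r a) fun _ => 0)
      (Sum.elim (fun a => Sum.elim (fun _ => 0) fun r => -M r a)
        fun _ => Sum.elim (fun a => -w a) fun r => d r))
    (Sum.elim d (Sum.elim (fun a => -w a) fun _ => 0)) with ⟨q, hq, hMq⟩ | ⟨q, hq, hqM, hpos⟩
  · refine ⟨fun a => q (Sum.inl a), fun r => q (Sum.inr r), ⟨fun a => hq _, fun r => ?_⟩,
      ⟨fun r => hq _, fun a => ?_⟩, ?_⟩
    · simpa using hMq (Sum.inl r)
    · have := hMq (Sum.inr (Sum.inl a))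
      simp at this
      calc _ = ∑ r, M r a * q (Sum.inr r) := Finset.sum_congr rfl fun r _ => mul_comm _ _
        _ ≤ _ := this
    · have := hMq (Sum.inr (Sum.inr ()))
      simp at this
      linarith
  · exfalso
    set u : R → ℝ := fun r => q (Sum.inl r)
    set v : C → ℝ := fun a => q (Sum.inr (Sum.inl a))
    set t : ℝ := q (Sum.inr (Sum.inr ()))
    have hu : ∀ r, 0 ≤ u r := fun r => hq _
    have hv : ∀ a, 0 ≤ v a := fun a => hq _
    have ht : 0 ≤ t := hq _
    have h1 : ∀ a, ∑ r, u r * M r a ≤ t * w a := fun a => by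
      have := hqM (Sum.inl a)
      simp at this
      linarith
    have h2 : ∀ r, t * d r ≤ ∑ a, M r a * v a := fun r => by
      have := hqM (Sum.inr r)
      simp at this
      have h3 : ∑ a, M r a * v a = ∑ a, v a * M r a :=
        Finset.sum_congr rfl fun a _ => mul_comm _ _
      linarith
    have h3 : ∑ a, w a * v a < ∑ r, d r * u r := by
      simp at hpos
      linarith
    -- For `t = 0`, `u` and `v` are recession directions, and weak duality against `y₀` and `z₀`
    -- separates their values by zero. For `t > 0`, `v / t` and `u / t` are a feasible pair that
    -- violates weak duality.
    rcases ht.eq_or_lt with ht | ht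
    · simp only [← ht, zero_mul] at h1 h2
      have h4 := weak_duality M d 0 y₀ u hy₀ hMy₀ hu fun a _ => h1 a
      have h5 := weak_duality M 0 w v z₀ hv h2 hz₀ fun a _ => hzM₀ a
      simp at h4 h5
      linarith
    · have h4 := weak_duality M d w (fun a => v a / t) (fun r => u r / t)
        (fun a => div_nonneg (hv a) ht.le)
        (fun r => by
          simp only [mul_div_assoc', ← Finset.sum_div]
          rw [le_div_iff₀ ht, mul_comm]; exact h2 r)
        (fun r => div_nonneg (hu r) ht.le)
        (fun a _ => by
          simp only [div_mul_eq_mul_div, ← Finset.sum_div]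
          rw [div_le_iff₀ ht, mul_comm (w a)]; exact h1 a)
      simp only [mul_div_assoc', ← Finset.sum_div] at h4
      rw [div_le_div_iff_of_pos_right ht] at h4
      linarith

end LinearProgram

/-! ### Extreme points of polyhedra -/

/-- A polyhedron has finitely many extreme points. -/
theorem finite_extremePoints_of_finite_inequalities {E ι : Type*} [AddCommGroup E] [Module ℝ E]
    [Finite ι] (l : ι → E →ₗ[ℝ] ℝ) (c : ι → ℝ) :
    (Set.extremePoints ℝ {z | ∀ i, l i z ≤ c i}).Finite := by
  classical
  cases nonempty_fintype ι
  -- An extreme point is determined by its set of active inequalities: if `z'` has the same ones,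
  -- `z` can be moved by a small `ε` both ways along `z - z'` inside the polyhedron.
  refine Set.Finite.of_finite_image (f := fun z => {i | l i z = c i}) (Set.toFinite _) ?_
  intro z hz z' hz' hact
  by_contra hne
  have hact' : ∀ i, l i z = c i → l i z' = c i := fun i hi => by
    have hact : {i | l i z = c i} = {i | l i z' = c i} := hact
    exact hact.subset hi
  have hzP := hz.1
  have key : ∃ ε : ℝ, 0 < ε ∧ ∀ i, ε * |l i (z - z')| ≤ c i - l i z ∨ l i z = c i := by
    have : ∀ i, ∃ ε : ℝ, 0 < ε ∧ (ε * |l i (z - z')| ≤ c i - l i z ∨ l i z = c i) := fun i => by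
      by_cases hi : l i z = c i
      · exact ⟨1, one_pos, Or.inr hi⟩
      · have h1 : 0 < c i - l i z := sub_pos.2 (lt_of_le_of_ne (hzP i) hi)
        have h2 : 0 < |l i (z - z')| + 1 := by positivity
        refine ⟨(c i - l i z) / (|l i (z - z')| + 1), div_pos h1 h2, Or.inl ?_⟩
        rw [div_mul_eq_mul_div, div_le_iff₀ h2]
        nlinarith
    choose ε hε h using this
    by_cases hι : Nonempty ι
    · refine ⟨Finset.univ.inf' Finset.univ_nonempty ε, ?_, fun i => (h i).imp_left fun hi => ?_⟩
      · simpa using hε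
      · exact (mul_le_mul_of_nonneg_right (Finset.inf'_le _ (Finset.mem_univ i))
          (abs_nonneg _)).trans hi
    · exact ⟨1, one_pos, fun i => (hι ⟨i⟩).elim⟩
  obtain ⟨ε, hε, h⟩ := key
  have hmem : ∀ σ : ℝ, |σ| = ε → z + σ • (z - z') ∈ {z | ∀ i, l i z ≤ c i} := fun σ hσ i => by
    rw [map_add, map_smul, smul_eq_mul]
    rcases h i with hi | hi
    · have : σ * l i (z - z') ≤ ε * |l i (z - z')| := by
        rw [← hσ, ← abs_mul]; exact le_abs_self _
      linarith
    · rw [map_sub, hi, hact' i hi]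
      simp
  have := hz.2 (hmem ε (abs_of_pos hε)) (hmem (-ε) (by rw [abs_neg, abs_of_pos hε]))
    ⟨1 / 2, 1 / 2, by norm_num, by norm_num, by norm_num, by module⟩
  have h0 : ε • (z - z') = 0 := by simpa using this
  rcases smul_eq_zero.1 h0 with h0 | h0
  · exact hε.ne' h0
  · exact hne (sub_eq_zero.1 h0)

/-- A linear functional that attains its maximum over `P` attains it at an extreme point, if `P`
has compact sublevel sets for some linear functional. -/
theorem exists_extremePoint_eq_of_isMaxOn {E : Type*} [AddCommGroup E] [Module ℝ E]
    [TopologicalSpace E] [T2Space E] [IsTopologicalAddGroup E] [ContinuousSMul ℝ E]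
    [LocallyConvexSpace ℝ E] {P : Set E} (f L : E →L[ℝ] ℝ)
    (hL : ∀ t, IsCompact {z ∈ P | L z ≤ t}) {z₀ : E} (hz₀ : z₀ ∈ P)
    (hmax : ∀ z ∈ P, f z ≤ f z₀) : ∃ z ∈ Set.extremePoints ℝ P, f z = f z₀ := by
  -- The face `F` of maximizers may be unbounded. Minimizing `L` over it gives a compact face `G`,
  -- which has an extreme point by Krein–Milman; a face of a face is extreme in `P`.
  set F : Set E := {z ∈ P | ∀ y ∈ P, f y ≤ f z} with hF
  have hFP : IsExposed ℝ P F := fun _ => ⟨f, rfl⟩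
  have hFeq : ∀ z ∈ F, f z = f z₀ := fun z hz => le_antisymm (hmax z hz.1) (hz.2 z₀ hz₀)
  have hK : IsCompact {z ∈ F | L z ≤ L z₀} := by
    have : {z ∈ F | L z ≤ L z₀} = {z ∈ P | L z ≤ L z₀} ∩ {z | f z = f z₀} := by
      ext z
      constructor
      · exact fun hz => ⟨⟨hz.1.1, hz.2⟩, hFeq z hz.1⟩
      · exact fun hz => ⟨⟨hz.1.1, fun y hy => (hmax y hy).trans hz.2.ge⟩, hz.1.2⟩
    rw [this]
    exact (hL _).inter_right (isClosed_eq f.continuous continuous_const)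
  have hz₀K : z₀ ∈ {z ∈ F | L z ≤ L z₀} := ⟨⟨hz₀, hmax⟩, le_rfl⟩
  obtain ⟨z₁, hz₁, hmin⟩ := hK.exists_isMinOn ⟨z₀, hz₀K⟩ L.continuous.continuousOn
  have hmin' : ∀ z ∈ F, L z₁ ≤ L z := fun z hz => by
    by_cases h : L z ≤ L z₀
    · exact hmin ⟨hz, h⟩
    · exact hz₁.2.trans (not_le.1 h).le
  set G : Set E := {z ∈ F | ∀ y ∈ F, (-L) y ≤ (-L) z} with hG
  have hGF : IsExposed ℝ F G := fun _ => ⟨-L, rfl⟩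
  have hz₁G : z₁ ∈ G := ⟨hz₁.1, fun y hy => by simpa using hmin' y hy⟩
  have hGc : IsCompact G := by
    have : G = {z ∈ F | L z ≤ L z₀} ∩ {z | L z = L z₁} := by
      ext z
      constructor
      · intro hz
        have : L z = L z₁ :=
          le_antisymm (by simpa using hz.2 z₁ hz₁.1) (hmin' z hz.1)
        exact ⟨⟨hz.1, this.le.trans hz₁.2⟩, this⟩
      · rintro ⟨hz, hz'⟩
        refine ⟨hz.1, fun y hy => ?_⟩
        have hz'' : L z = L z₁ := hz'
        simpa [hz''] using hmin' y hy
    rw [this]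
    exact hK.inter_right (isClosed_eq L.continuous continuous_const)
  obtain ⟨z, hz⟩ := hGc.extremePoints_nonempty ⟨z₁, hz₁G⟩
  exact ⟨z, (hFP.isExtreme.trans hGF.isExtreme).extremePoints_subset_extremePoints hz,
    hFeq z hz.1.1⟩
-- Duality and extreme vectors of the Benders subproblems
noncomputable section

namespace TwoStageProblem

variable {D : TwoStageProblem} {s : D.S} {j : D.J}

/-! ### The subproblem as a linear program in standard form -/

/-- Node-arc incidence matrix. -/
def incidence (n : D.Node s j) (a : D.Arc s j) : ℝ := by
  classical exact (if D.src a = n then 1 else 0) - (if D.tgt a = n then 1 else 0)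

/-- Rows of the subproblem; a flow balance equation is written as two inequalities. -/
abbrev Row (D : TwoStageProblem) (s : D.S) (j : D.J) := D.Node s j ⊕ D.Node s j ⊕ D.Side s j

/-- Constraint matrix of the subproblem. -/
def coeff : D.Row s j → D.Arc s j → ℝ :=
  Sum.elim (fun n a => incidence n a) (Sum.elim (fun n a => -incidence n a) fun r a => D.f a r)

/-- Right-hand side of the subproblem. -/
def rhs (x : D.XVec) : D.Row s j → ℝ :=
  Sum.elim (fun n => D.netSupply x n) (Sum.elim (fun n => -D.netSupply x n) D.h)

/-- Coordinates of a dual vector, as linear functionals. -/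
def coord : D.Row s j → D.DualVec s j →ₗ[ℝ] ℝ :=
  Sum.elim (fun n => LinearMap.proj n ∘ₗ LinearMap.fst ℝ _ _)
    (Sum.elim (fun n => LinearMap.proj n ∘ₗ LinearMap.fst ℝ _ _ ∘ₗ LinearMap.snd ℝ _ _)
      fun r => LinearMap.proj r ∘ₗ LinearMap.snd ℝ _ _ ∘ₗ LinearMap.snd ℝ _ _)

/-- The dual vector with given coordinates. -/
def ofCoord (q : D.Row s j → ℝ) : D.DualVec s j :=
  (fun n => q (.inl n), fun n => q (.inr (.inl n)), fun r => q (.inr (.inr r)))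

@[simp] theorem coord_ofCoord (q : D.Row s j → ℝ) (r : D.Row s j) : coord r (ofCoord q) = q r := by
  rcases r with n | n | r <;> rfl

@[simp] theorem coord_inl (z : D.DualVec s j) (n : D.Node s j) : coord (.inl n) z = z.1 n := rfl

@[simp] theorem coord_inr_inl (z : D.DualVec s j) (n : D.Node s j) :
    coord (.inr (.inl n)) z = z.2.1 n := rfl

@[simp] theorem coord_inr_inr (z : D.DualVec s j) (r : D.Side s j) :
    coord (.inr (.inr r)) z = z.2.2 r := rfl

theorem sum_incidence_mul (n : D.Node s j) (y : D.Arc s j → ℝ) [DecidableEq (D.Node s j)] :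
    ∑ a, incidence n a * y a = (∑ a with D.src a = n, y a) - ∑ a with D.tgt a = n, y a := by
  simp only [incidence, sub_mul, Finset.sum_sub_distrib, ite_mul, one_mul, zero_mul,
    Finset.sum_filter]

theorem sum_mul_incidence (ψ : D.Node s j → ℝ) (a : D.Arc s j) :
    ∑ n, ψ n * incidence n a = ψ (D.src a) - ψ (D.tgt a) := by
  classical
  simp [incidence, mul_sub, Finset.sum_sub_distrib]

theorem linking_iff (x : D.XVec) (y : D.Arc s j → ℝ) :
    D.Linking x y ↔ ∀ r, rhs x r ≤ ∑ a, coeff r a * y a := by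
  classical
  have h : D.Linking x y ↔ (∀ n : D.Node s j, ∑ a, incidence n a * y a = D.netSupply x n) ∧
      ∀ r : D.Side s j, D.h r ≤ ∑ a, D.f a r * y a := by
    simp only [sum_incidence_mul]
    unfold Linking
    congr!
  rw [h]
  simp only [Sum.forall, rhs, coeff, Sum.elim_inl, Sum.elim_inr, neg_mul, Finset.sum_neg_distrib,
    neg_le_neg_iff, ← and_assoc, ← forall_and]
  simp only [le_antisymm_iff, and_comm]

theorem sum_coord_mul_coeff (z : D.DualVec s j) (a : D.Arc s j) :
    ∑ r, coord r z * coeff r a =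
      (D.ofStd z).1 (D.src a) - (D.ofStd z).1 (D.tgt a) + ∑ r, (D.ofStd z).2 r * D.f a r := by
  simp only [Fintype.sum_sum_type, coord_inl, coord_inr_inl, coord_inr_inr, coeff, Sum.elim_inl,
    Sum.elim_inr, mul_neg, Finset.sum_neg_distrib, sum_mul_incidence, ofStd, Pi.sub_apply]
  ring

theorem redCost_eq (w : D.Arc s j → ℝ) (z : D.DualVec s j) (a : D.Arc s j) :
    D.redCost w z a = w a - ∑ r, coord r z * coeff r a := by
  rw [sum_coord_mul_coeff, redCost]
  ring

theorem dualObj_eq (x : D.XVec) (z : D.DualVec s j) :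
    D.dualObj x z = ∑ r, rhs x r * coord r z := by
  simp only [Fintype.sum_sum_type, coord_inl, coord_inr_inl, coord_inr_inr, rhs, Sum.elim_inl,
    Sum.elim_inr, neg_mul, Finset.sum_neg_distrib, dualObj, ofStd, Pi.sub_apply, mul_sub,
    Finset.sum_sub_distrib]
  ring

theorem mem_dualStd_iff (w : D.Arc s j → ℝ) (A' : Set (D.Arc s j)) (z : D.DualVec s j) :
    z ∈ D.dualStd w A' ↔ (∀ r, 0 ≤ coord r z) ∧ ∀ a ∈ A', ∑ r, coord r z * coeff r a ≤ w a := by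
  simp only [sum_coord_mul_coeff, dualStd, dualPoly, Set.mem_ofPred_eq, Sum.forall, coord_inl,
    coord_inr_inl, coord_inr_inr, Pi.le_def, Pi.zero_apply, and_assoc]
  rfl

theorem redCost_nonneg_of_mem_dualStd {w : D.Arc s j → ℝ} {A' : Set (D.Arc s j)}
    {z : D.DualVec s j} (hz : z ∈ D.dualStd w A') {a : D.Arc s j} (ha : a ∈ A') :
    0 ≤ D.redCost w z a := by
  rw [redCost_eq]
  exact sub_nonneg.2 (((mem_dualStd_iff w A' z).1 hz).2 a ha)

/-- Reduced costs are the slacks of the dual constraints, so the pricing test is exactly dual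
feasibility on the arcs left out. -/
theorem mem_dualStd_univ_of_redCost_nonneg {w : D.Arc s j → ℝ} {A' : Set (D.Arc s j)}
    {z : D.DualVec s j} (hz : z ∈ D.dualStd w A') (h : ∀ a, 0 ≤ D.redCost w z a) :
    z ∈ D.dualStd w Set.univ := by
  refine (mem_dualStd_iff _ _ _).2 ⟨((mem_dualStd_iff w A' z).1 hz).1, fun a _ => ?_⟩
  have := h a
  rw [redCost_eq] at this
  exact sub_nonneg.1 this

theorem dualStd_anti {w : D.Arc s j → ℝ} {A' A'' : Set (D.Arc s j)} (h : A' ⊆ A'') :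
    D.dualStd w A'' ⊆ D.dualStd w A' := fun z hz => by
  rw [mem_dualStd_iff] at hz ⊢
  exact ⟨hz.1, fun a ha => hz.2 a (h ha)⟩

theorem dualStd_nonempty {w : D.Arc s j → ℝ} {A' : Set (D.Arc s j)}
    (h : (D.dualPoly (s := s) (j := j) w A').Nonempty) : (D.dualStd w A').Nonempty := by
  obtain ⟨p, hp⟩ := h
  refine ⟨(p.1⁺, p.1⁻, p.2), posPart_nonneg _, negPart_nonneg _, ?_⟩
  simpa [ofStd, posPart_sub_negPart] using hp

/-! ### Duality for restricted subproblems -/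

/-- Columns outside `A'` are replaced by zero. -/
theorem sum_indicator_mul (A' : Set (D.Arc s j)) (y w : D.Arc s j → ℝ) :
    ∑ a, A'.indicator w a * y a = ∑ a, w a * A'.indicator y a := by
  classical
  refine Finset.sum_congr rfl fun a _ => ?_
  by_cases h : a ∈ A' <;> simp [h]

/-- Off `A'` both sides vanish, so zeroed columns impose nothing on `q`. -/
theorem sum_mul_indicator_coeff_le (A' : Set (D.Arc s j)) (q : D.Row s j → ℝ)
    (w : D.Arc s j → ℝ) :
    (∀ a, ∑ r, q r * A'.indicator (coeff r) a ≤ A'.indicator w a) ↔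
      ∀ a ∈ A', ∑ r, q r * coeff r a ≤ w a := by
  classical
  refine forall_congr' fun a => ?_
  by_cases h : a ∈ A' <;> simp [h]

theorem rspFeasible_indicator {x : D.XVec} {A' : Set (D.Arc s j)} {y : D.Arc s j → ℝ}
    (hy : ∀ a, 0 ≤ y a) (h : ∀ r, rhs x r ≤ ∑ a, A'.indicator (coeff r) a * y a) :
    D.RSPFeasible x A' (A'.indicator y) := by
  refine ⟨(linking_iff x _).2 fun r => ?_, fun a => Set.indicator_nonneg (fun a _ => hy a) a,
    fun a ha => Set.indicator_of_notMem ha y⟩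
  rw [← sum_indicator_mul]
  exact h r

/-- Dual constraints of absent arcs are not needed, since `y` vanishes there. The costs `w` are kept
free: `D.g` serves optimality cuts and `0` serves feasibility cuts. -/
theorem RSPFeasible.dualObj_le {x : D.XVec} {A' : Set (D.Arc s j)} {y : D.Arc s j → ℝ}
    {w : D.Arc s j → ℝ} {z : D.DualVec s j} (hy : D.RSPFeasible x A' y)
    (hz : z ∈ D.dualStd w A') : D.dualObj x z ≤ ∑ a, w a * y a := by
  rw [mem_dualStd_iff] at hz
  rw [dualObj_eq]
  exact weak_duality coeff (rhs x) w y (fun r => coord r z) hy.2.1 ((linking_iff x y).1 hy.1) hz.1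
    fun a ha => hz.2 a (by_contra fun h => ha (hy.2.2 a h))

theorem rspFeasible_univ_iff {x : D.XVec} {y : D.Arc s j → ℝ} :
    D.RSPFeasible x Set.univ y ↔ D.BSPFeasible x y := by
  simp [RSPFeasible, BSPFeasible]

theorem RSPFeasible.bspFeasible {x : D.XVec} {A' : Set (D.Arc s j)} {y : D.Arc s j → ℝ}
    (hy : D.RSPFeasible x A' y) : D.BSPFeasible x y := ⟨hy.1, hy.2.1⟩

theorem exists_rspFeasible_or_exists_ray (x : D.XVec) (A' : Set (D.Arc s j)) :
    (∃ y, D.RSPFeasible x A' y) ∨ ∃ z ∈ D.dualStd 0 A', 0 < D.dualObj x z := by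
  rcases exists_primal_or_exists_ray (fun r => A'.indicator (coeff r)) (rhs x) with
    ⟨y, hy, h⟩ | ⟨q, hq, hqM, hpos⟩
  · exact Or.inl ⟨_, rspFeasible_indicator hy h⟩
  · refine Or.inr ⟨ofCoord q, (mem_dualStd_iff _ _ _).2 ⟨by simpa using hq, ?_⟩, ?_⟩
    · simpa using (sum_mul_indicator_coeff_le A' q 0).1 (by simpa using hqM)
    · simpa [dualObj_eq] using hpos

theorem exists_rspFeasible_le_dualObj {x : D.XVec} {A' : Set (D.Arc s j)}
    (hp : ∃ y, D.RSPFeasible x A' y) (hd : (D.dualStd D.g A').Nonempty) :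
    ∃ y z, D.RSPFeasible x A' y ∧ z ∈ D.dualStd D.g A' ∧ D.yCost y ≤ D.dualObj x z := by
  obtain ⟨y₀, hy₀⟩ := hp
  obtain ⟨z₀, hz₀⟩ := hd
  rw [mem_dualStd_iff] at hz₀
  have hind : A'.indicator y₀ = y₀ :=
    Set.indicator_eq_self.2 fun a ha => by_contra fun h => ha (hy₀.2.2 a h)
  obtain ⟨y, q, ⟨hy, hMy⟩, ⟨hq, hqM⟩, hle⟩ := strong_duality
    (fun r => A'.indicator (coeff r)) (rhs x) (A'.indicator D.g)
    ⟨y₀, hy₀.2.1, fun r => by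
      rw [sum_indicator_mul, hind]; exact (linking_iff x y₀).1 hy₀.1 r⟩
    ⟨fun r => coord r z₀, hz₀.1, (sum_mul_indicator_coeff_le A' _ _).2 hz₀.2⟩
  -- The solution for the zeroed matrix may be nonzero off `A'`; truncating it changes neither the
  -- constraints nor the cost.
  refine ⟨A'.indicator y, ofCoord q, rspFeasible_indicator hy hMy, (mem_dualStd_iff _ _ _).2
    ⟨by simpa using hq, by simpa using (sum_mul_indicator_coeff_le A' q _).1 hqM⟩, ?_⟩
  rw [sum_indicator_mul] at hle
  simpa [dualObj_eq, yCost] using hle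

/-- Optimal primal and dual solutions of a restricted subproblem have equal values. -/
theorem LPOut.Correct.yCost_le_dualObj {x : D.XVec} {A' : Set (D.Arc s j)} {y : D.Arc s j → ℝ}
    {z : D.DualVec s j} (h : (LPOut.solved y z).Correct x A') : D.yCost y ≤ D.dualObj x z := by
  obtain ⟨⟨hy, hymin⟩, hz, hzmax⟩ := h
  obtain ⟨y', z', hy', hz', hle⟩ := exists_rspFeasible_le_dualObj ⟨y, hy⟩ ⟨z, hz⟩
  exact (hymin y' hy').trans (hle.trans (hzmax z' hz'))

theorem exists_correct (x : D.XVec) (A' : Set (D.Arc s j)) (hd : (D.dualStd D.g A').Nonempty) :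
    ∃ o : D.LPOut s j, o.Correct x A' := by
  by_cases hp : ∃ y, D.RSPFeasible x A' y
  · obtain ⟨y, z, hy, hz, hle⟩ := exists_rspFeasible_le_dualObj hp hd
    exact ⟨.solved y z, ⟨hy, fun y' hy' => hle.trans (hy'.dualObj_le hz)⟩, hz,
      fun z' hz' => (hy.dualObj_le hz').trans hle⟩
  · obtain ⟨z, hz, hpos⟩ := (exists_rspFeasible_or_exists_ray x A').resolve_left hp
    exact ⟨.infeasible z, hp, hz, hpos⟩

/-! ### Extreme points and extreme rays -/

/-- Coordinate sum of a dual vector. -/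
def coordSum : D.DualVec s j →ₗ[ℝ] ℝ := ∑ r, coord r

theorem coordSum_apply (z : D.DualVec s j) :
    coordSum z = ∑ n, z.1 n + ∑ n, z.2.1 n + ∑ r, z.2.2 r := by
  simp [coordSum, Fintype.sum_sum_type, add_assoc]

/-- The dual objective as a linear functional. -/
def dualObjL (x : D.XVec) : D.DualVec s j →ₗ[ℝ] ℝ := ∑ r, rhs x r • coord r

theorem dualObjL_apply (x : D.XVec) (z : D.DualVec s j) : dualObjL x z = D.dualObj x z := by
  simp [dualObjL, dualObj_eq]

/-- The slice of the recession cone whose extreme points are the extreme rays. -/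
def raySlice (D : TwoStageProblem) (s : D.S) (j : D.J) : Set (D.DualVec s j) :=
  {z | z ∈ D.dualStd (s := s) (j := j) 0 Set.univ ∧
      ∑ n, z.1 n + ∑ n, z.2.1 n + ∑ r, z.2.2 r = 1}

/-- The functionals that define the dual polyhedron. -/
def dualConstraint : D.Row s j ⊕ D.Arc s j → D.DualVec s j →ₗ[ℝ] ℝ :=
  Sum.elim (fun r => -coord r) fun a => ∑ r, coeff r a • coord r

/-- The right-hand sides of the inequalities that define the dual polyhedron. -/
def dualBound (w : D.Arc s j → ℝ) : D.Row s j ⊕ D.Arc s j → ℝ := Sum.elim (fun _ => 0) w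

theorem dualStd_univ_eq (w : D.Arc s j → ℝ) :
    D.dualStd w Set.univ = {z | ∀ i, dualConstraint i z ≤ dualBound w i} := by
  ext z
  have h : ∀ a, dualConstraint (.inr a) z = ∑ r, coord r z * coeff r a := fun a => by
    simp [dualConstraint, mul_comm]
  rw [mem_dualStd_iff]
  constructor
  · rintro ⟨h1, h2⟩ (r | a)
    · exact neg_nonpos.2 (h1 r)
    · exact (h a).trans_le (h2 a trivial)
  · exact fun hz => ⟨fun r => neg_nonpos.1 (hz (.inl r)), fun a _ => (h a).ge.trans (hz (.inr a))⟩

theorem finite_extPts (D : TwoStageProblem) (s : D.S) (j : D.J) : (D.extPts s j).Finite := by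
  rw [extPts, dualStd_univ_eq]
  exact finite_extremePoints_of_finite_inequalities _ _

theorem raySlice_eq (D : TwoStageProblem) (s : D.S) (j : D.J) :
    D.raySlice s j = {z | z ∈ D.dualStd 0 Set.univ ∧ coordSum z = 1} :=
  Set.ext fun z => by rw [raySlice, Set.mem_ofPred_eq, Set.mem_ofPred_eq, coordSum_apply]

theorem finite_extRays (D : TwoStageProblem) (s : D.S) (j : D.J) : (D.extRays s j).Finite := by
  have : D.raySlice s j = {z | ∀ i,
      Sum.elim dualConstraint (Sum.elim (fun _ : Unit => coordSum) fun _ : Unit => -coordSum) i z ≤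
        Sum.elim (dualBound 0) (Sum.elim (fun _ : Unit => 1) fun _ : Unit => -1) i} := by
    ext z
    rw [raySlice_eq, dualStd_univ_eq]
    constructor
    · rintro ⟨h1, h2⟩ (i | i | i)
      exacts [h1 i, h2.le, neg_le_neg h2.ge]
    · exact fun h => ⟨fun i => h (.inl i),
        le_antisymm (h (.inr (.inl ()))) (neg_le_neg_iff.1 (h (.inr (.inr ()))))⟩
  rw [extRays, ← raySlice, this]
  exact finite_extremePoints_of_finite_inequalities _ _

theorem isClosed_dualStd_univ (w : D.Arc s j → ℝ) : IsClosed (D.dualStd w Set.univ) := by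
  rw [dualStd_univ_eq, Set.ofPred_forall]
  exact isClosed_iInter fun i => isClosed_le
    (dualConstraint i).continuous_of_finiteDimensional continuous_const

/-- All coordinates are nonnegative, so each is at most their sum. This is the gain from splitting
`ψ`. -/
theorem isCompact_dualStd_inter_coordSum_le (w : D.Arc s j → ℝ) (t : ℝ) :
    IsCompact {z ∈ D.dualStd w Set.univ | coordSum z ≤ t} := by
  refine IsCompact.of_isClosed_subset
    (isCompact_Icc (a := (0 : D.DualVec s j)) (b := (fun _ => t, fun _ => t, fun _ => t)))
    ((isClosed_dualStd_univ w).inter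
      (isClosed_le coordSum.continuous_of_finiteDimensional continuous_const)) ?_
  rintro z ⟨hz, hzt⟩
  have h0 := ((mem_dualStd_iff _ _ _).1 hz).1
  have h1 : ∀ r, coord r z ≤ t := fun r => by
    have hs : coordSum z = ∑ r, coord r z := by simp [coordSum]
    exact (Finset.single_le_sum (f := fun r => coord r z) (fun r _ => h0 r)
      (Finset.mem_univ r)).trans (hs ▸ hzt)
  exact ⟨⟨fun n => h0 (.inl n), fun n => h0 (.inr (.inl n)), fun r => h0 (.inr (.inr r))⟩,
    ⟨fun n => h1 (.inl n), fun n => h1 (.inr (.inl n)), fun r => h1 (.inr (.inr r))⟩⟩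

theorem exists_mem_extPts_dualObj_eq {x : D.XVec} {z : D.DualVec s j}
    (hz : z ∈ D.dualStd D.g Set.univ)
    (hmax : ∀ z' ∈ D.dualStd (s := s) (j := j) D.g Set.univ, D.dualObj x z' ≤ D.dualObj x z) :
    ∃ z' ∈ D.extPts s j, D.dualObj x z' = D.dualObj x z := by
  simp only [← dualObjL_apply] at hmax ⊢
  exact exists_extremePoint_eq_of_isMaxOn (dualObjL x).toContinuousLinearMap
    coordSum.toContinuousLinearMap (isCompact_dualStd_inter_coordSum_le D.g) hz hmax

/-- The ray has positive coordinate sum, as otherwise it would be zero with zero objective.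
Rescaled, it lies in the compact slice, and the maximum of the objective there is attained at an
extreme point. -/
theorem exists_mem_extRays_dualObj_pos {x : D.XVec} {z : D.DualVec s j}
    (hz : z ∈ D.dualStd 0 Set.univ) (hpos : 0 < D.dualObj x z) :
    ∃ z' ∈ D.extRays s j, 0 < D.dualObj x z' := by
  have hz' := (mem_dualStd_iff _ _ _).1 hz
  have hsum : coordSum z = ∑ r, coord r z := by simp [coordSum]
  have h0 : 0 < coordSum z := by
    rw [hsum]
    refine (Finset.sum_nonneg fun r _ => hz'.1 r).lt_of_ne fun h => ?_
    have := (Finset.sum_eq_zero_iff_of_nonneg fun r _ => hz'.1 r).1 h.symm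
    rw [dualObj_eq, Finset.sum_eq_zero fun r hr => by rw [this r hr, mul_zero]] at hpos
    exact hpos.false
  have hcompact : ∀ t, IsCompact {z ∈ D.raySlice s j | coordSum z ≤ t} := fun t => by
    have : {z ∈ D.raySlice s j | coordSum z ≤ t} =
        {z ∈ D.dualStd 0 Set.univ | coordSum z ≤ t} ∩ {z | coordSum z = 1} := by
      ext z
      simp only [raySlice_eq, Set.mem_ofPred_eq, Set.mem_inter_iff]
      tauto
    rw [this]
    exact (isCompact_dualStd_inter_coordSum_le 0 t).inter_right
      (isClosed_eq coordSum.continuous_of_finiteDimensional continuous_const)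
  have hslice : IsCompact (D.raySlice s j) := by
    convert hcompact 1 using 1
    ext z
    simp only [raySlice_eq, Set.mem_ofPred_eq]
    exact ⟨fun h => ⟨h, h.2.le⟩, fun h => h.1⟩
  have hmem : (coordSum z)⁻¹ • z ∈ D.raySlice s j := by
    simp only [raySlice_eq, Set.mem_ofPred_eq]
    refine ⟨(mem_dualStd_iff _ _ _).2 ⟨fun r => ?_, fun a ha => ?_⟩, ?_⟩
    · rw [map_smul]
      exact mul_nonneg (inv_nonneg.2 h0.le) (hz'.1 r)
    · simp only [map_smul, smul_eq_mul, mul_assoc, ← Finset.mul_sum]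
      exact mul_nonpos_of_nonneg_of_nonpos (inv_nonneg.2 h0.le) (hz'.2 a ha)
    · rw [map_smul, smul_eq_mul, inv_mul_cancel₀ h0.ne']
  obtain ⟨z₁, hz₁, hmax⟩ := hslice.exists_isMaxOn ⟨_, hmem⟩
    (dualObjL x).continuous_of_finiteDimensional.continuousOn
  obtain ⟨z₂, hz₂, heq⟩ := exists_extremePoint_eq_of_isMaxOn (dualObjL x).toContinuousLinearMap
    coordSum.toContinuousLinearMap hcompact hz₁ hmax
  refine ⟨z₂, hz₂, ?_⟩
  have h1 : dualObjL x ((coordSum z)⁻¹ • z) ≤ dualObjL x z₁ := hmax hmem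
  have h2 : dualObjL x z₂ = dualObjL x z₁ := heq
  rw [map_smul, smul_eq_mul, dualObjL_apply x z] at h1
  rw [← dualObjL_apply, h2]
  exact (mul_pos (inv_pos.2 h0) hpos).trans_le h1

end TwoStageProblem

end
-- Correctness and termination of the algorithm
noncomputable section

namespace TwoStageProblem

variable {D : TwoStageProblem}

/-! ### Weighted sums over scenarios and blocks -/

theorem sum_sum_prob_mul_le {θ θ' : D.Theta} (h : ∀ s j, θ s j ≤ θ' s j) :
    ∑ s, ∑ j, D.prob s * θ s j ≤ ∑ s, ∑ j, D.prob s * θ' s j :=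
  Finset.sum_le_sum fun s _ => Finset.sum_le_sum fun j _ =>
    mul_le_mul_of_nonneg_left (h s j) (D.prob_nonneg s)

theorem sum_sum_lt_sum_sum {f g : D.S → D.J → ℕ} (hle : ∀ s j, f s j ≤ g s j)
    (hlt : ∃ s j, f s j < g s j) : ∑ s, ∑ j, f s j < ∑ s, ∑ j, g s j := by
  obtain ⟨s, j, h⟩ := hlt
  exact Finset.sum_lt_sum (fun s _ => Finset.sum_le_sum fun j _ => hle s j)
    ⟨s, Finset.mem_univ s,
      Finset.sum_lt_sum (fun j _ => hle s j) ⟨j, Finset.mem_univ j, h⟩⟩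

/-! ### Relaxations -/

theorem arcDomain_nonneg {κ : VarKind} {t : ℝ} (h : t ∈ κ.arcDomain) : 0 ≤ t := by
  cases κ with
  | real => exact h
  | integer => obtain ⟨m, rfl⟩ := h; exact m.cast_nonneg
  | binary => rcases h with rfl | rfl <;> norm_num

theorem FullFeasible.relaxFeasible {x : D.XVec} {y : D.YVec} (h : D.FullFeasible x y) :
    D.RelaxFeasible x y :=
  ⟨h.1, fun s j => ⟨(h.2 s j).1, fun a => arcDomain_nonneg ((h.2 s j).2 a)⟩⟩

theorem BSPFeasible.dualObj_le {s : D.S} {j : D.J} {x : D.XVec} {y w : D.Arc s j → ℝ}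
    {z : D.DualVec s j} (hy : D.BSPFeasible x y) (hz : z ∈ D.dualStd w Set.univ) :
    D.dualObj x z ≤ ∑ a, w a * y a :=
  (rspFeasible_univ_iff.2 hy).dualObj_le hz

/-- The cuts consist of extreme points and extreme rays and include the initial optimality cuts. -/
def ValidCuts (U₀ U V : D.Cuts) : Prop :=
  (∀ s j, U₀ s j ⊆ U s j) ∧ (∀ s j, U s j ⊆ D.extPts s j) ∧ ∀ s j, V s j ⊆ D.extRays s j

/-- Benders cuts are valid for the partial relaxation. -/
theorem RelaxFeasible.mpFeasible {U₀ U V : D.Cuts} (hUV : ValidCuts U₀ U V) {x : D.XVec}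
    {y : D.YVec} (h : D.RelaxFeasible x y) : D.MPFeasible U V x fun s j => D.yCost (y s j) := by
  refine ⟨h.1, fun s j u hu => (h.2 s j).dualObj_le (hUV.2.1 s j hu).1, fun s j v hv => ?_⟩
  simpa using (h.2 s j).dualObj_le (hUV.2.2 s j hv).1.1

theorem MPOptimal.masterObj_le_cost {U₀ U V : D.Cuts} (hUV : ValidCuts U₀ U V) {x : D.XVec}
    {θ : D.Theta} (h : D.MPOptimal U V x θ) {x' : D.XVec} {y' : D.YVec}
    (h' : D.RelaxFeasible x' y') : D.masterObj x θ ≤ D.cost x' y' :=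
  h.2 _ _ (h'.mpFeasible hUV)

/-! ### One iteration -/

theorem LPOut.AddCut.subset {s : D.S} {j : D.J} {o : D.LPOut s j}
    {U V U' V' : Set (D.DualVec s j)} (h : o.AddCut U V U' V') : U ⊆ U' ∧ V ⊆ V' := by
  cases o with
  | solved y z => obtain ⟨-, rfl, rfl⟩ := h; exact ⟨Set.subset_insert _ _, subset_rfl⟩
  | infeasible z => obtain ⟨-, rfl, rfl⟩ := h; exact ⟨subset_rfl, Set.subset_insert _ _⟩

theorem LPOut.AddCut.subset_ext {s : D.S} {j : D.J} {o : D.LPOut s j}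
    {U V U' V' : Set (D.DualVec s j)} (h : o.AddCut U V U' V') (hU : U ⊆ D.extPts s j)
    (hV : V ⊆ D.extRays s j) : U' ⊆ D.extPts s j ∧ V' ⊆ D.extRays s j := by
  cases o with
  | solved y z => obtain ⟨hz, rfl, rfl⟩ := h; exact ⟨Set.insert_subset hz hU, hV⟩
  | infeasible z => obtain ⟨hz, rfl, rfl⟩ := h; exact ⟨hU, Set.insert_subset hz hV⟩

/-- A cut that is added for a violated recourse approximation is new. -/
theorem LPOut.AddCut.exists_new {s : D.S} {j : D.J} {o : D.LPOut s j}
    {U V U' V' : Set (D.DualVec s j)} {x : D.XVec} {A' : Set (D.Arc s j)} {t : ℝ}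
    (h : o.AddCut U V U' V') (ho : o.Correct x A') (hviol : o.Violated t)
    (hU : ∀ u ∈ U, D.dualObj x u ≤ t) (hV : ∀ v ∈ V, D.dualObj x v ≤ 0) :
    (∃ z ∈ D.extPts s j, z ∈ U' ∧ z ∉ U) ∨ ∃ z ∈ D.extRays s j, z ∈ V' ∧ z ∉ V := by
  cases o with
  | solved y z =>
    obtain ⟨hz, rfl, rfl⟩ := h
    exact Or.inl ⟨z, hz, Set.mem_insert _ _,
      fun hzU => ((ho.yCost_le_dualObj.trans (hU z hzU)).trans_lt hviol).false⟩
  | infeasible z =>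
    obtain ⟨hz, rfl, rfl⟩ := h
    exact Or.inr ⟨z, hz, Set.mem_insert _ _, fun hzV => (ho.2.2.trans_le (hV z hzV)).false⟩

/-- Arcs already present are never priced out, so each added arc is new. -/
theorem LPOut.Correct.rc_nonneg {s : D.S} {j : D.J} {o : D.LPOut s j} {x : D.XVec}
    {A' : Set (D.Arc s j)} (ho : o.Correct x A') {a : D.Arc s j} (ha : a ∈ A') : 0 ≤ o.rc a := by
  cases o with
  | solved y z => exact redCost_nonneg_of_mem_dualStd ho.2.1 ha
  | infeasible z => exact redCost_nonneg_of_mem_dualStd ho.2.1 ha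

theorem LPOut.exists_addColumn {s : D.S} {j : D.J} (o : D.LPOut s j) (A' : Set (D.Arc s j)) :
    ∃ A'', o.AddColumn A' A'' := by
  by_cases h : ∃ a, o.rc a < 0
  · obtain ⟨a₀, ha₀⟩ := h
    have : Nonempty (D.Arc s j) := ⟨a₀⟩
    obtain ⟨a, ha⟩ := Finite.exists_min o.rc
    exact ⟨_, Or.inl ⟨a, (ha a₀).trans_lt ha₀, ha, rfl⟩⟩
  · push Not at h
    exact ⟨_, Or.inr ⟨h, rfl⟩⟩

theorem LPOut.AddColumn.subset {s : D.S} {j : D.J} {o : D.LPOut s j} {A' A'' : Set (D.Arc s j)}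
    (h : o.AddColumn A' A'') : A' ⊆ A'' := by
  rcases h with ⟨a, -, -, rfl⟩ | ⟨-, rfl⟩
  exacts [Set.subset_insert _ _, subset_rfl]

theorem LPOut.AddColumn.ssubset {s : D.S} {j : D.J} {o : D.LPOut s j} {x : D.XVec}
    {A' A'' : Set (D.Arc s j)} (h : o.AddColumn A' A'') (ho : o.Correct x A')
    (hneg : ∃ a, o.rc a < 0) : A' ⊂ A'' := by
  rcases h with ⟨a, ha, -, rfl⟩ | ⟨hpos, -⟩
  · exact Set.ssubset_insert fun haA => ((ho.rc_nonneg haA).trans_lt ha).false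
  · obtain ⟨a, ha⟩ := hneg
    exact ((hpos a).trans_lt ha).false.elim

/-- When column generation has ended, the dual answer can be replaced by an extreme point or an
extreme ray. -/
theorem LPOut.Correct.exists_addCut {s : D.S} {j : D.J} {o : D.LPOut s j} {x : D.XVec}
    {A' : Set (D.Arc s j)} (ho : o.Correct x A') (hpos : ∀ a, 0 ≤ o.rc a)
    (U V : Set (D.DualVec s j)) :
    ∃ o' : D.LPOut s j, o'.Correct x A' ∧ (∀ a, 0 ≤ o'.rc a) ∧
      (∀ t, o.Violated t → o'.Violated t) ∧ ∃ U' V', o'.AddCut U V U' V' := by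
  cases o with
  | solved y z =>
    have hz := mem_dualStd_univ_of_redCost_nonneg ho.2.1 hpos
    -- The full dual polyhedron is contained in the restricted one, so `z` is optimal there too; an
    -- extreme point of equal value is then optimal for both.
    obtain ⟨z', hz', heq⟩ := exists_mem_extPts_dualObj_eq (x := x) hz fun z' hz' =>
      ho.2.2 z' (dualStd_anti (Set.subset_univ _) hz')
    exact ⟨.solved y z', ⟨ho.1, dualStd_anti (Set.subset_univ _) hz'.1,
      fun z'' hz'' => (ho.2.2 z'' hz'').trans heq.ge⟩,
      fun a => redCost_nonneg_of_mem_dualStd hz'.1 trivial, fun _ h => h, _, _, hz', rfl, rfl⟩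
  | infeasible z =>
    have hz := mem_dualStd_univ_of_redCost_nonneg ho.2.1 hpos
    obtain ⟨z', hz', hobj⟩ := exists_mem_extRays_dualObj_pos hz ho.2.2
    exact ⟨.infeasible z', ⟨ho.1, dualStd_anti (Set.subset_univ _) hz'.1.1, hobj⟩,
      fun a => redCost_nonneg_of_mem_dualStd hz'.1.1 trivial, fun _ h => h, _, _, hz', rfl, rfl⟩

/-- The column generation loop never gets stuck. -/
theorem exists_step_sub
    (hdual : ∀ s j, (D.dualPoly (s := s) (j := j) D.g Set.univ).Nonempty) (U V : D.Cuts)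
    (x : D.XVec) (θ : D.Theta) (A' : ∀ s j, Set (D.Arc s j)) :
    ∃ σ, D.Step (.sub U V x θ A') σ := by
  choose out hout using fun s j => exists_correct x (A' s j)
    ((dualStd_nonempty (hdual s j)).mono (dualStd_anti (Set.subset_univ _)))
  by_cases hneg : ∃ s j a, (out s j).rc a < 0
  · choose A'' hA'' using fun s j => (out s j).exists_addColumn (A' s j)
    exact ⟨_, .addColumns U V x θ A' A'' out hout hneg hA''⟩
  push Not at hneg
  by_cases hviol : ∃ s j, (out s j).Violated (θ s j)
  · choose out' hout' hpos' hviol' U' V' hadd using fun s j =>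
      (hout s j).exists_addCut (hneg s j) (U s j) (V s j)
    obtain ⟨s, j, h⟩ := hviol
    exact ⟨_, .addCuts U V U' V' x θ A' out' hout' hpos' ⟨s, j, hviol' s j _ h⟩ hadd⟩
  · have hsolved : ∀ s j, ∃ y z, out s j = .solved y z := fun s j => by
      cases h : out s j with
      | solved y z => exact ⟨y, z, rfl⟩
      | infeasible z => exact (hviol ⟨s, j, by rw [h]; trivial⟩).elim
    choose y hy using hsolved
    exact ⟨_, .terminate U V x θ A' out y hout hneg hviol hy⟩

/-! ### Invariants -/

/-- Properties of the states that occur in a run. -/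
def Invariant (U₀ : D.Cuts) : D.State → Prop
  | .master U V => ValidCuts U₀ U V
  | .sub U V x θ _ => ValidCuts U₀ U V ∧ D.MPOptimal U V x θ
  | .infeasible => ¬ ∃ x y, D.RelaxFeasible x y
  | .optimal x θ y => D.RelaxFeasible x y ∧ D.cost x y ≤ D.masterObj x θ ∧
      ∀ x' y', D.RelaxFeasible x' y' → D.masterObj x θ ≤ D.cost x' y'

theorem Step.invariant {U₀ : D.Cuts} {σ σ' : D.State} (h : D.Step σ σ') (hσ : Invariant U₀ σ) :
    Invariant U₀ σ' := by
  cases h with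
  | masterInfeasible U V hMP =>
    rintro ⟨x, y, hxy⟩
    exact hMP ⟨_, _, hxy.mpFeasible hσ⟩
  | masterSolved U V x θ A' hMP => exact ⟨hσ, hMP⟩
  | addColumns U V x θ A' A'' out hout hneg hadd => exact hσ
  | addCuts U V U' V' x θ A' out hout hpos hviol hadd =>
    obtain ⟨⟨h1, h2, h3⟩, -⟩ := hσ
    exact ⟨fun s j => (h1 s j).trans (hadd s j).subset.1,
      fun s j => ((hadd s j).subset_ext (h2 s j) (h3 s j)).1,
      fun s j => ((hadd s j).subset_ext (h2 s j) (h3 s j)).2⟩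
  | terminate U V x θ A' out y hout hpos hviol hy =>
    obtain ⟨hUV, hMP⟩ := hσ
    have key : ∀ s j, D.BSPFeasible x (y s j) ∧ D.yCost (y s j) ≤ θ s j := fun s j => by
      obtain ⟨z, hz⟩ := hy s j
      have h1 := hout s j
      have h2 : ¬ (out s j).Violated (θ s j) := fun h => hviol ⟨s, j, h⟩
      rw [hz] at h1 h2
      exact ⟨h1.1.1.bspFeasible, not_lt.1 h2⟩
    exact ⟨⟨hMP.1.1, fun s j => (key s j).1⟩,
      add_le_add_right (sum_sum_prob_mul_le fun s j => (key s j).2) _,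
      fun x' y' h' => hMP.masterObj_le_cost hUV h'⟩

theorem Reachable.invariant {U₀ V₀ : D.Cuts} (hU₀ : ∀ s j, U₀ s j ⊆ D.extPts s j)
    (hV₀ : ∀ s j, V₀ s j ⊆ D.extRays s j) {σ : D.State} (h : D.Reachable U₀ V₀ σ) :
    Invariant U₀ σ := by
  induction h with
  | refl => exact ⟨fun s j => subset_rfl, hU₀, hV₀⟩
  | tail _ hstep ih => exact hstep.invariant ih

/-! ### Finiteness -/

/-- Number of cuts that have not been added. -/
def missingCuts (U V : D.Cuts) : ℕ :=
  ∑ s, ∑ j, ((D.extPts s j \ U s j).ncard + (D.extRays s j \ V s j).ncard)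

/-- Number of arcs that have not been added. -/
def missingArcs (A' : ∀ s j, Set (D.Arc s j)) : ℕ := ∑ s, ∑ j, (A' s j)ᶜ.ncard

/-- A bound on the number of iterations that remain. -/
def remaining : D.State → ℕ
  | .master U V =>
      missingCuts U V * (missingArcs (D := D) (fun _ _ => ∅) + 3) +
        (missingArcs (D := D) (fun _ _ => ∅) + 2)
  | .sub U V _ _ A' =>
      missingCuts U V * (missingArcs (D := D) (fun _ _ => ∅) + 3) + (missingArcs A' + 1)
  | .infeasible => 0
  | .optimal _ _ _ => 0

theorem missingArcs_le (A' : ∀ s j, Set (D.Arc s j)) :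
    missingArcs A' ≤ missingArcs (D := D) fun _ _ => ∅ :=
  Finset.sum_le_sum fun _ _ => Finset.sum_le_sum fun _ _ =>
    Set.ncard_le_ncard (Set.compl_subset_compl.2 (Set.empty_subset _)) (Set.toFinite _)

theorem missingArcs_lt {x : D.XVec} {A' A'' : ∀ s j, Set (D.Arc s j)} {out : ∀ s j, D.LPOut s j}
    (hout : ∀ s j, (out s j).Correct x (A' s j)) (hneg : ∃ s j a, (out s j).rc a < 0)
    (hadd : ∀ s j, (out s j).AddColumn (A' s j) (A'' s j)) : missingArcs A'' < missingArcs A' := by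
  obtain ⟨s, j, h⟩ := hneg
  exact sum_sum_lt_sum_sum
    (fun s j => Set.ncard_le_ncard (Set.compl_subset_compl.2 (hadd s j).subset) (Set.toFinite _))
    ⟨s, j, Set.ncard_lt_ncard (compl_lt_compl_iff_lt.2 ((hadd s j).ssubset (hout s j) h))
      (Set.toFinite _)⟩

theorem missingCuts_lt {U V U' V' : D.Cuts} {x : D.XVec} {θ : D.Theta}
    {A' : ∀ s j, Set (D.Arc s j)} {out : ∀ s j, D.LPOut s j} (hMP : D.MPFeasible U V x θ)
    (hout : ∀ s j, (out s j).Correct x (A' s j)) (hviol : ∃ s j, (out s j).Violated (θ s j))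
    (hadd : ∀ s j, (out s j).AddCut (U s j) (V s j) (U' s j) (V' s j)) :
    missingCuts U' V' < missingCuts U V := by
  obtain ⟨s, j, h⟩ := hviol
  have hU : ∀ s j, (D.extPts s j \ U' s j).ncard ≤ (D.extPts s j \ U s j).ncard := fun s j =>
    Set.ncard_le_ncard (Set.sdiff_subset_sdiff_right (hadd s j).subset.1)
      ((finite_extPts D s j).subset Set.sdiff_subset)
  have hV : ∀ s j, (D.extRays s j \ V' s j).ncard ≤ (D.extRays s j \ V s j).ncard := fun s j =>
    Set.ncard_le_ncard (Set.sdiff_subset_sdiff_right (hadd s j).subset.2)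
      ((finite_extRays D s j).subset Set.sdiff_subset)
  refine sum_sum_lt_sum_sum (fun s j => add_le_add (hU s j) (hV s j)) ⟨s, j, ?_⟩
  rcases (hadd s j).exists_new (hout s j) h (hMP.2.1 s j) (hMP.2.2 s j) with
    ⟨z, hz, hz', hzU⟩ | ⟨z, hz, hz', hzV⟩
  · refine add_lt_add_of_lt_of_le (Set.ncard_lt_ncard ((Set.ssubset_iff_of_subset
      (Set.sdiff_subset_sdiff_right (hadd s j).subset.1)).2 ⟨z, ⟨hz, hzU⟩, fun h => h.2 hz'⟩)
      ((finite_extPts D s j).subset Set.sdiff_subset)) (hV s j)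
  · refine add_lt_add_of_le_of_lt (hU s j) (Set.ncard_lt_ncard ((Set.ssubset_iff_of_subset
      (Set.sdiff_subset_sdiff_right (hadd s j).subset.2)).2 ⟨z, ⟨hz, hzV⟩, fun h => h.2 hz'⟩)
      ((finite_extRays D s j).subset Set.sdiff_subset))

/-- With `M` arcs in total, a master state carries the offset `M + 2`, above any offset `missingArcs
A' + 1` of column generation. The weight `M + 3` per missing cut pays for resetting the arc sets,
and the final `+ 1` leaves room for the terminating step. -/
theorem Step.remaining_lt {U₀ : D.Cuts} {σ σ' : D.State} (h : D.Step σ σ')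
    (hσ : Invariant U₀ σ) : remaining σ' < remaining σ := by
  cases h with
  | masterInfeasible U V hMP => simp [remaining]
  | masterSolved U V x θ A' hMP =>
    have := missingArcs_le A'
    simp only [remaining]
    omega
  | addColumns U V x θ A' A'' out hout hneg hadd =>
    have := missingArcs_lt hout hneg hadd
    simp only [remaining]
    omega
  | addCuts U V U' V' x θ A' out hout hpos hviol hadd =>
    have := missingCuts_lt hσ.2.1 hout hviol hadd
    simp only [remaining]
    nlinarith
  | terminate U V x θ A' out y hout hpos hviol hy => simp [remaining]

theorem length_le_remaining {U₀ : D.Cuts} {n : ℕ} {σ : ℕ → D.State} (h₀ : Invariant U₀ (σ 0))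
    (hstep : ∀ i < n, D.Step (σ i) (σ (i + 1))) : n ≤ remaining (σ 0) := by
  have key : ∀ i ≤ n, Invariant U₀ (σ i) ∧ remaining (σ i) + i ≤ remaining (σ 0) := by
    intro i
    induction i with
    | zero => exact fun _ => ⟨h₀, le_rfl⟩
    | succ i ih =>
      intro hi
      obtain ⟨h1, h2⟩ := ih (Nat.le_of_succ_le hi)
      have := (hstep i hi).remaining_lt h1
      exact ⟨(hstep i hi).invariant h1, by omega⟩
  have := (key n le_rfl).2
  omega

/-! ### Solvability of the master problem -/

theorem isClosed_firstStageDomain (κ : VarKind) : IsClosed κ.firstStageDomain := by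
  cases κ with
  | real => exact isClosed_univ
  | integer => exact Int.isClosedEmbedding_coe_real.isClosed_range
  | binary => exact (Set.toFinite {(0 : ℝ), 1}).isClosed

theorem isClosed_firstStage (D : TwoStageProblem) : IsClosed D.firstStage := by
  simp only [firstStage, Set.ofPred_and, Set.ofPred_forall]
  refine IsClosed.inter (isClosed_iInter fun k => ?_) (isClosed_iInter fun i => ?_)
  · exact (isClosed_firstStageDomain _).preimage (continuous_apply k)
  · exact isClosed_le continuous_const (by fun_prop)

theorem continuous_xCost (D : TwoStageProblem) : Continuous D.xCost := by
  unfold xCost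
  fun_prop

theorem continuous_dualObj {s : D.S} {j : D.J} (z : D.DualVec s j) :
    Continuous fun x => D.dualObj x z := by
  unfold dualObj netSupply
  fun_prop

/-- For fixed `x` the best `θ` is the maximum of the finitely many cut values, which needs a cut in
each `U s j`. The master problem becomes the minimization of a continuous function over a compact
set. -/
theorem exists_mpOptimal (hbd : Bornology.IsBounded D.firstStage) {U V : D.Cuts}
    (hfin : ∀ s j, (U s j).Finite) (hne : ∀ s j, (U s j).Nonempty)
    (hfeas : ∃ x θ, D.MPFeasible U V x θ) : ∃ x θ, D.MPOptimal U V x θ := by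
  have hne' : ∀ s j, (hfin s j).toFinset.Nonempty := fun s j =>
    (hfin s j).toFinset_nonempty.2 (hne s j)
  let θ : D.XVec → D.Theta := fun x s j =>
    (hfin s j).toFinset.sup' (hne' s j) fun u => D.dualObj x u
  have hθ : ∀ x s j, ∀ u ∈ U s j, D.dualObj x u ≤ θ x s j := fun x s j u hu =>
    Finset.le_sup' (fun u => D.dualObj x u) ((hfin s j).mem_toFinset.2 hu)
  have hcont : Continuous fun x => D.masterObj x (θ x) := by
    refine (continuous_xCost D).add (continuous_finsetSum _ fun s _ =>
      continuous_finsetSum _ fun j _ => continuous_const.mul ?_)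
    exact Continuous.finset_sup'_apply (hne' s j) fun u _ => continuous_dualObj u
  set X : Set D.XVec := D.firstStage ∩ {x | ∀ s j, ∀ v ∈ V s j, D.dualObj x v ≤ 0} with hX
  have hXc : IsCompact X := by
    refine (Metric.isCompact_of_isClosed_isBounded (isClosed_firstStage D) hbd).inter_right ?_
    simp only [Set.ofPred_forall]
    exact isClosed_iInter fun s => isClosed_iInter fun j => isClosed_iInter fun v =>
      isClosed_iInter fun _ => isClosed_le (continuous_dualObj v) continuous_const
  obtain ⟨x₀, θ₀, h₀⟩ := hfeas
  obtain ⟨x, hx, hmin⟩ := hXc.exists_isMinOn ⟨x₀, h₀.1, h₀.2.2⟩ hcont.continuousOn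
  refine ⟨x, θ x, ⟨hx.1, hθ x, hx.2⟩, fun x' θ' h' => ?_⟩
  have h1 : D.masterObj x (θ x) ≤ D.masterObj x' (θ x') := hmin ⟨h'.1, h'.2.2⟩
  exact h1.trans (add_le_add_right (sum_sum_prob_mul_le fun s j =>
    Finset.sup'_le _ _ fun u hu => h'.2.1 s j u ((hfin s j).mem_toFinset.1 hu)) _)

/-- A run stops only with an answer, or at a feasible master problem without optimal solution. -/
theorem Halted.cases {σ : D.State}
    (hdual : ∀ s j, (D.dualPoly (s := s) (j := j) D.g Set.univ).Nonempty) (h : D.Halted σ) :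
    σ = .infeasible ∨ (∃ x θ y, σ = .optimal x θ y) ∨
      ∃ U V, σ = .master U V ∧ (∃ x θ, D.MPFeasible U V x θ) ∧ ¬ ∃ x θ, D.MPOptimal U V x θ := by
  cases σ with
  | master U V =>
    refine Or.inr (Or.inr ⟨U, V, rfl, ?_, ?_⟩)
    · by_contra hMP
      exact h ⟨_, .masterInfeasible U V hMP⟩
    · rintro ⟨x, θ, hMP⟩
      -- Any initial arc sets are allowed, so the empty ones suffice.
      exact h ⟨_, .masterSolved U V x θ (fun _ _ => ∅) hMP⟩
  | sub U V x θ A' => exact (h (exists_step_sub hdual U V x θ A')).elim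
  | infeasible => exact Or.inl rfl
  | optimal x θ y => exact Or.inr (Or.inl ⟨x, θ, y, rfl⟩)

end TwoStageProblem

end

theorem theorem1 (D : TwoStageProblem) (U₀ V₀ : D.Cuts)
    (hU₀ : ∀ s j, U₀ s j ⊆ D.extPts s j) (hV₀ : ∀ s j, V₀ s j ⊆ D.extRays s j)
    (hdual : ∀ s j, (D.dualPoly (s := s) (j := j) D.g Set.univ).Nonempty) :
    -- the number of iterations of every run is finite, with a common bound
    (∃ B : ℕ, ∀ (n : ℕ) (σ : ℕ → D.State), σ 0 = .master U₀ V₀ →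
      (∀ i < n, D.Step (σ i) (σ (i + 1))) → n ≤ B) ∧
    -- a run stops only with an answer, or at a feasible master problem without optimal solution
    (∀ σ, D.Reachable U₀ V₀ σ → D.Halted σ →
      σ = .infeasible ∨ (∃ x θ y, σ = .optimal x θ y) ∨
      ∃ U V, σ = .master U V ∧ (∃ x θ, D.MPFeasible U V x θ) ∧ ¬ ∃ x θ, D.MPOptimal U V x θ) ∧
    -- it always stops with an answer if the first-stage feasible set is bounded and the initial
    -- master problem has a cut on each of the recourse variables
    (Bornology.IsBounded D.firstStage → (∀ s j, (U₀ s j).Nonempty) →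
      ∀ σ, D.Reachable U₀ V₀ σ → D.Halted σ →
        σ = .infeasible ∨ ∃ x θ y, σ = .optimal x θ y) ∧
    -- the answer "infeasible" is correct
    (D.Reachable U₀ V₀ .infeasible → ¬ ∃ x y, D.RelaxFeasible x y) ∧
    -- the returned solution is optimal for the partial relaxation, and gives a valid gap
    (∀ x θ y, D.Reachable U₀ V₀ (.optimal x θ y) →
      D.RelaxOptimal x y ∧ D.masterObj x θ = D.cost x y ∧
      (D.masterObj x θ : EReal) ≤ D.OPT ∧ D.OPT ≤ D.OPTat x ∧
      ∀ y', D.SPFeasible x y' →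
        D.FullFeasible x y' ∧ 0 ≤ D.gap x θ y' ∧
        ∀ x'' y'', D.FullFeasible x'' y'' → D.cost x y' ≤ D.cost x'' y'' + D.gap x θ y') := by
  -- The common bound is `remaining` of the initial master state, which does not depend on the run.
  refine ⟨⟨_, fun n σ h₀ hstep => TwoStageProblem.length_le_remaining (U₀ := U₀)
      (h₀ ▸ (⟨fun s j => subset_rfl, hU₀, hV₀⟩ : TwoStageProblem.ValidCuts U₀ U₀ V₀)) hstep
        |>.trans_eq (congrArg _ h₀)⟩,
    fun σ _ h => h.cases hdual, fun hbd hne σ hσ h => ?_,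
    fun h => h.invariant hU₀ hV₀, fun x θ y h => ?_⟩
  · rcases h.cases hdual with h | h | ⟨U, V, rfl, hfeas, hopt⟩
    · exact Or.inl h
    · exact Or.inr h
    · have hUV : TwoStageProblem.ValidCuts U₀ U V := hσ.invariant hU₀ hV₀
      exact (hopt (TwoStageProblem.exists_mpOptimal hbd
        (fun s j => (TwoStageProblem.finite_extPts D s j).subset (hUV.2.1 s j))
        (fun s j => (hne s j).mono (hUV.1 s j)) hfeas)).elim
  -- The cost of `(x, y)` is at most the master value, which is at most the cost of every relaxed
  -- solution; taking `(x, y)` itself gives equality.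
  · obtain ⟨hfeas, hle, hlb⟩ := h.invariant hU₀ hV₀
    have hfull : ∀ y', D.SPFeasible x y' → D.FullFeasible x y' := fun y' hy' => ⟨hfeas.1, hy'⟩
    refine ⟨⟨hfeas, fun x' y' h' => hle.trans (hlb x' y' h')⟩, le_antisymm (hlb x y hfeas) hle,
      le_iInf fun x' => le_iInf fun y' => le_iInf fun h' =>
        EReal.coe_le_coe_iff.2 (hlb x' y' h'.relaxFeasible),
      le_iInf fun y' => le_iInf fun hy' => iInf_le_of_le x (iInf_le_of_le y'
        (iInf_le_of_le (hfull y' hy') le_rfl)),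
      fun y' hy' => ⟨hfull y' hy', sub_nonneg.2 (hlb x y' (hfull y' hy').relaxFeasible),
        fun x'' y'' h'' => ?_⟩⟩
    have := hlb x'' y'' h''.relaxFeasible
    rw [TwoStageProblem.gap]
    linarith
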